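/- Let $m\ge 0$ be an integer. Let $\mathcal P(^m c_0)$ be the space of continuous $m$-homogeneous polynomials $P(x)=A(x,\dots,x)$ ($A$ a continuous $m$-linear form) on the complex space $c_0$, normed by $\|P\|=\sup_{\|x\|_\infty\le 1}|P(x)|$. For $P\in\mathcal P(^m c_0)$ let $A$ be the associated symmetric $m$-linear form, and let $\tilde A$ be its Arens extension to $c_0^{**}=\ell_\infty$, that is, the $m$-linear form $\tilde A(z_1,\dots,z_m)=z_1\big(x_1\mapsto z_2(x_2\mapsto\cdots z_m(x_m\mapsto A(x_1,\dots,x_m))\cdots)\big)$, which extends $A$ and is weak$^*$-continuous in $z_j$ whenever the first $j-1$ variables lie in $c_0$. Here $z\in\ell_\infty$ acts on $\varphi\in c_0^*$ by $z(\varphi)=\sum_n z_n\varphi(e_n)$. Let $AB(P)(z)=\tilde A(z,\dots,z)$, $z\in\ell_\infty$, be the Aron–Berner extension of $P$. Let $\mathbb T^\infty=\mathbb T^{\mathbb N}\subset\ell_\infty$ carry the product $\mu$ of the normalized Lebesgue measures on the circle $\mathbb T$; for $f\in L_\infty(\mathbb T^\infty)$ and a finitely supported $\alpha\in\mathbb Z^{(\mathbb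 N)}$ let $\hat f(\alpha)=\int_{\mathbb T^\infty} f(w)\,w^{-\alpha}\,d\mu(w)$. Let $H_\infty^m(\mathbb T^\infty)$ be the subspace, with the norm of $L_\infty(\mathbb T^\infty)$, of those $f\in L_\infty(\mathbb T^\infty)$ such that $\hat f(\alpha)\neq 0$ only if all $\alpha_n\ge 0$ and $|\alpha|=\sum_n\alpha_n=m$. Then the mapping $\psi:\mathcal P(^m c_0)\to H_\infty^m(\mathbb T^\infty)$ given by $\psi(P)(w)=AB(P)(w)$ for ($\mu$-almost every) $w\in\mathbb T^\infty$ is a well-defined, linear, surjective isometry. -/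

import Mathlib

open MeasureTheory Filter Topology
open scoped ENNReal ZeroAtInfty

noncomputable section

namespace AronBerner

/-! ### Homogeneous polynomials on a complex normed space -/

section Polynomials

variable (m : ℕ) (X : Type*) [NormedAddCommGroup X] [NormedSpace ℂ X]

/-- Continuous `m`-linear forms on `X`. -/
abbrev Form : Type _ := ContinuousMultilinearMap ℂ (fun _ : Fin m => X) ℂ

/-- The functions `P : X → ℂ` of the form `P x = A (x, …, x)`, with `A` a continuous
`m`-linear form. -/
def homPolySubmodule : Submodule ℂ (X → ℂ) where
  carrier := {P | ∃ A : Form m X, ∀ x, P x = A fun _ => x}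
  zero_mem' := ⟨0, fun _ => rfl⟩
  add_mem' := by
    rintro P Q ⟨A, hA⟩ ⟨B, hB⟩
    exact ⟨A + B, fun x => by simp [hA, hB]⟩
  smul_mem' := by
    rintro c P ⟨A, hA⟩
    exact ⟨c • A, fun x => by simp [hA]⟩

/-- The space `𝒫(ᵐX)` of continuous `m`-homogeneous polynomials on `X`. -/
def HomPoly : Type _ := homPolySubmodule m X

instance : AddCommGroup (HomPoly m X) := inferInstanceAs (AddCommGroup (homPolySubmodule m X))

instance : Module ℂ (HomPoly m X) := inferInstanceAs (Module ℂ (homPolySubmodule m X))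

variable {m X}

instance : CoeFun (HomPoly m X) (fun _ => X → ℂ) := ⟨fun P => P.1⟩

@[ext] theorem HomPoly.ext {P Q : HomPoly m X} (h : ∀ x, P x = Q x) : P = Q :=
  Subtype.ext (funext h)

theorem HomPoly.exists_form (P : HomPoly m X) : ∃ A : Form m X, ∀ x, P x = A fun _ => x := P.2

@[simp] theorem HomPoly.zero_apply (x : X) : (0 : HomPoly m X) x = 0 := rfl

@[simp] theorem HomPoly.add_apply (P Q : HomPoly m X) (x : X) : (P + Q) x = P x + Q x := rfl

@[simp] theorem HomPoly.smul_apply (c : ℂ) (P : HomPoly m X) (x : X) : (c • P) x = c * P x := rfl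

theorem HomPoly.map_smul (P : HomPoly m X) (c : ℂ) (x : X) : P (c • x) = c ^ m * P x := by
  obtain ⟨A, hA⟩ := P.exists_form
  rw [hA, hA]
  simpa using A.map_smul_univ (fun _ => c) (fun _ => x)

/-- The norm of a polynomial: its supremum on the closed unit ball. -/
instance : Norm (HomPoly m X) := ⟨fun P => ⨆ x : Metric.closedBall (0 : X) 1, ‖P x‖⟩

theorem HomPoly.norm_def (P : HomPoly m X) :
    ‖P‖ = ⨆ x : Metric.closedBall (0 : X) 1, ‖P x‖ := rfl

theorem HomPoly.bddAbove (P : HomPoly m X) :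
    BddAbove (Set.range fun x : Metric.closedBall (0 : X) 1 => ‖P x‖) := by
  obtain ⟨A, hA⟩ := P.exists_form
  refine ⟨‖A‖, ?_⟩
  rintro _ ⟨⟨x, hx⟩, rfl⟩
  have hx1 : ‖x‖ ≤ 1 := by simpa using hx
  calc ‖P x‖ = ‖A fun _ => x‖ := by rw [hA]
    _ ≤ ‖A‖ * ∏ _i : Fin m, ‖x‖ := A.le_opNorm _
    _ ≤ ‖A‖ * 1 := by
      gcongr
      simpa using pow_le_one₀ (norm_nonneg x) hx1
    _ = ‖A‖ := mul_one _

theorem HomPoly.norm_apply_le (P : HomPoly m X) {x : X} (hx : ‖x‖ ≤ 1) : ‖P x‖ ≤ ‖P‖ :=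
  le_ciSup P.bddAbove ⟨x, by simpa using hx⟩

theorem HomPoly.norm_le {P : HomPoly m X} {C : ℝ} (h : ∀ x : X, ‖x‖ ≤ 1 → ‖P x‖ ≤ C) :
    ‖P‖ ≤ C := by
  have : Nonempty (Metric.closedBall (0 : X) 1) := ⟨⟨0, by simp⟩⟩
  exact ciSup_le fun x => h x (mem_closedBall_zero_iff.1 x.2)

theorem HomPoly.normCore : NormedSpace.Core ℂ (HomPoly m X) where
  norm_nonneg P := (norm_nonneg _).trans (P.norm_apply_le (x := 0) (by simp))
  norm_smul c P := by
    rw [HomPoly.norm_def, HomPoly.norm_def, Real.mul_iSup_of_nonneg (norm_nonneg c)]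
    simp
  norm_triangle P Q := HomPoly.norm_le fun x hx =>
    (norm_add_le _ _).trans (add_le_add (P.norm_apply_le hx) (Q.norm_apply_le hx))
  norm_eq_zero_iff P := by
    constructor
    · intro h
      ext x
      have hpos : (0 : ℝ) < ‖x‖ + 1 := by positivity
      have hne : ((‖x‖ + 1 : ℝ) : ℂ) ≠ 0 := by exact_mod_cast hpos.ne'
      have hball : ‖(((‖x‖ + 1 : ℝ) : ℂ)⁻¹) • x‖ ≤ 1 := by
        rw [norm_smul, norm_inv, Complex.norm_real, Real.norm_of_nonneg hpos.le,
          inv_mul_le_iff₀ hpos]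
        linarith
      have h0 := P.norm_apply_le hball
      rw [h] at h0
      have h1 := norm_le_zero_iff.1 h0
      have h2 := P.map_smul ((‖x‖ + 1 : ℝ) : ℂ) ((((‖x‖ + 1 : ℝ) : ℂ)⁻¹) • x)
      rw [smul_inv_smul₀ hne, h1, mul_zero] at h2
      exact h2
    · rintro rfl
      simp [HomPoly.norm_def]

instance : NormedAddCommGroup (HomPoly m X) := NormedAddCommGroup.ofCore HomPoly.normCore

instance : NormedSpace ℂ (HomPoly m X) := NormedSpace.ofCore HomPoly.normCore

/-- Symmetry of an `m`-linear form. -/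
def IsSymm (A : Form m X) : Prop :=
  ∀ (σ : Equiv.Perm (Fin m)) (v : Fin m → X), A (fun i => v (σ i)) = A v

theorem HomPoly.exists_symm_form (P : HomPoly m X) :
    ∃ A : Form m X, IsSymm A ∧ ∀ x, P x = A fun _ => x := by
  obtain ⟨A, hA⟩ := P.exists_form
  refine ⟨((m.factorial : ℂ)⁻¹) • ∑ σ : Equiv.Perm (Fin m), A.domDomCongr σ, ?_, ?_⟩
  · intro τ v
    simp only [_root_.smul_apply, sum_apply,
      ContinuousMultilinearMap.domDomCongr_apply]
    congr 1
    exact Fintype.sum_equiv (Equiv.mulLeft τ) _ _ fun σ => rfl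
  · intro x
    simp only [_root_.smul_apply, sum_apply,
      ContinuousMultilinearMap.domDomCongr_apply, Finset.sum_const, Finset.card_univ,
      Fintype.card_perm, Fintype.card_fin, nsmul_eq_mul, smul_eq_mul, hA]
    rw [inv_mul_cancel_left₀ (by exact_mod_cast m.factorial_ne_zero)]

/-- A symmetric form is determined by its values on the diagonal. -/
theorem IsSymm.ext_diag {A B : Form m X} (hA : IsSymm A) (hB : IsSymm B)
    (h : ∀ x, (A fun _ => x) = B fun _ => x) : A = B := by
  ext v
  have h1 := A.iteratedFDeriv_comp_diagonal 0 v
  have h2 := B.iteratedFDeriv_comp_diagonal 0 v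
  have h3 : (fun x : X => A fun _ => x) = fun x => B fun _ => x := funext h
  rw [h3, h2] at h1
  simp only [hA _ v, hB _ v, Finset.sum_const, Finset.card_univ, Fintype.card_perm,
    Fintype.card_fin, nsmul_eq_mul] at h1
  exact (mul_left_cancel₀ (by exact_mod_cast m.factorial_ne_zero) h1).symm

/-- The symmetric `m`-linear form associated with a polynomial (unique by `IsSymm.ext_diag`). -/
def HomPoly.symmForm (P : HomPoly m X) : Form m X := P.exists_symm_form.choose

theorem HomPoly.symmForm_isSymm (P : HomPoly m X) : IsSymm P.symmForm :=
  P.exists_symm_form.choose_spec.1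

theorem HomPoly.symmForm_diag (P : HomPoly m X) (x : X) : P x = P.symmForm fun _ => x :=
  P.exists_symm_form.choose_spec.2 x

end Polynomials

/-! ### The Arens and Aron–Berner extensions -/

section Extension

variable (X : Type*) [NormedAddCommGroup X] [NormedSpace ℂ X]

/-- The bidual of `X`. -/
abbrev Bidual : Type _ := StrongDual ℂ (StrongDual ℂ X)

set_option maxSynthPendingDepth 4 in
/-- One step of the Arens extension: a bounded operator `B` from `X` to the `m`-linear forms on
`X**` is extended to `X**` by `(z, z₁, …, zₘ) ↦ z (x ↦ B x (z₁, …, zₘ))`. -/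
def arensStep (m : ℕ) : (X →L[ℂ] Form m (Bidual X)) →L[ℂ] (Bidual X →L[ℂ] Form m (Bidual X)) :=
  (ContinuousLinearMap.compContinuousMultilinearMapL ℂ (fun _ : Fin m => Bidual X)
      (StrongDual ℂ X) ℂ).flip ∘L
    (ContinuousLinearMap.flipMultilinearEquiv ℂ (fun _ : Fin m => Bidual X) X
      ℂ).toContinuousLinearMap

set_option maxSynthPendingDepth 4 in
/-- The Arens extension of `m`-linear forms from `X` to `X**`:
`Ã (z₁, …, zₘ) = z₁ (x₁ ↦ z₂ (x₂ ↦ ⋯ zₘ (xₘ ↦ A (x₁, …, xₘ)) ⋯ ))`. -/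
def arens : ∀ m : ℕ, Form m X →L[ℂ] Form m (Bidual X)
  | 0 =>
    (continuousMultilinearCurryFin0 ℂ (Bidual X) ℂ).symm.toContinuousLinearEquiv.toContinuousLinearMap
      ∘L (continuousMultilinearCurryFin0 ℂ X ℂ).toContinuousLinearEquiv.toContinuousLinearMap
  | m + 1 =>
    (continuousMultilinearCurryLeftEquiv ℂ (fun _ : Fin (m + 1) => Bidual X)
        ℂ).symm.toContinuousLinearEquiv.toContinuousLinearMap
      ∘L arensStep X m
      ∘L ContinuousLinearMap.compL ℂ X (Form m X) (Form m (Bidual X)) (arens m)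
      ∘L (continuousMultilinearCurryLeftEquiv ℂ (fun _ : Fin (m + 1) => X)
        ℂ).toContinuousLinearEquiv.toContinuousLinearMap

variable {X}

theorem arens_zero (A : Form 0 X) (z : Fin 0 → Bidual X) : arens X 0 A z = A 0 := rfl

theorem arens_succ {m : ℕ} (A : Form (m + 1) X) (z : Fin (m + 1) → Bidual X) :
    arens X (m + 1) A z =
      z 0 (((arens X m) ∘L A.curryLeft).flipMultilinear (Fin.tail z)) := rfl

/-- `Ã` extends `A`. -/
theorem arens_inclusion {m : ℕ} (A : Form m X) (x : Fin m → X) :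
    arens X m A (fun i => NormedSpace.inclusionInDoubleDual ℂ X (x i)) = A x := by
  induction m with
  | zero => rw [arens_zero, Subsingleton.elim x 0]
  | succ m ih =>
    rw [arens_succ, NormedSpace.dual_def]
    change arens X m (A.curryLeft (x 0)) (fun i => NormedSpace.inclusionInDoubleDual ℂ X
      (Fin.tail x i)) = A x
    rw [ih, ContinuousMultilinearMap.curryLeft_apply, Fin.cons_self_tail]

/-- `Ã (x₁, …, x_{j-1}, z, z_{j+1}, …, zₘ)` is weak*-continuous in `z ∈ X**` when
`x₁, …, x_{j-1} ∈ X`. -/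
theorem arens_weakStar_continuous {m : ℕ} (A : Form m X) (j : Fin m) (v : Fin m → Bidual X)
    (hv : ∀ i < j, v i ∈ Set.range (NormedSpace.inclusionInDoubleDual ℂ X)) :
    Continuous fun z : WeakDual ℂ (StrongDual ℂ X) =>
      arens X m A (Function.update v j (WeakDual.toStrongDual z)) := by
  induction m with
  | zero => exact j.elim0
  | succ m ih =>
    obtain rfl | ⟨j, rfl⟩ := Fin.eq_zero_or_eq_succ j
    · have key : ∀ z : Bidual X, arens X (m + 1) A (Function.update v 0 z) =
          z (((arens X m) ∘L A.curryLeft).flipMultilinear (Fin.tail v)) := fun z => by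
        rw [arens_succ, Function.update_self, Fin.tail_update_zero]
      refine Continuous.congr ?_ fun z => (key (WeakDual.toStrongDual z)).symm
      exact WeakDual.eval_continuous _
    · obtain ⟨x, hx⟩ := hv 0 (Fin.succ_pos j)
      have key : ∀ z : Bidual X, arens X (m + 1) A (Function.update v j.succ z) =
          arens X m (A.curryLeft x) (Function.update (Fin.tail v) j z) := fun z => by
        rw [arens_succ, Function.update_of_ne (Fin.succ_ne_zero j).symm, ← hx,
          NormedSpace.dual_def, Fin.tail_update_succ]
        rfl
      refine Continuous.congr ?_ fun z => (key (WeakDual.toStrongDual z)).symm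
      exact ih (A.curryLeft x) j (Fin.tail v) fun i hi => hv i.succ (Fin.succ_lt_succ_iff.2 hi)

/-- The Aron–Berner extension `AB(P) = P̃ ∈ 𝒫(ᵐX**)` of `P ∈ 𝒫(ᵐX)`: the restriction to the
diagonal of the Arens extension of the symmetric form associated with `P`. -/
def aronBerner {m : ℕ} (P : HomPoly m X) : HomPoly m (Bidual X) :=
  ⟨fun z => arens X m P.symmForm fun _ => z, arens X m P.symmForm, fun _ => rfl⟩

end Extension

/-! ### `ℓ∞` as the bidual of `c₀` -/

/-- `c₀`: complex null sequences with the supremum norm. -/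
abbrev CZero : Type := C₀(ℕ, ℂ)

/-- `ℓ∞`: bounded complex sequences with the supremum norm. -/
abbrev LInfty : Type := lp (fun _ : ℕ => ℂ) ∞

/-- The unit vectors of `c₀`. -/
def unitVec (n : ℕ) : CZero where
  toFun := Pi.single n 1
  continuous_toFun := continuous_of_discreteTopology
  zero_at_infty' := by
    rw [cocompact_eq_atTop]
    refine tendsto_const_nhds.congr' ?_
    filter_upwards [eventually_gt_atTop n] with k hk
    simp [hk.ne']

theorem sum_norm_apply_unitVec_le (φ : StrongDual ℂ CZero) (s : Finset ℕ) :
    ∑ n ∈ s, ‖φ (unitVec n)‖ ≤ ‖φ‖ := by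
  choose c hc hcφ using fun n : ℕ => RCLike.exists_norm_eq_mul_self (φ (unitVec n))
  set x : CZero := ∑ n ∈ s, c n • unitVec n with hx
  have hval : ∀ k, x k = ∑ n ∈ s, c n * (Pi.single n (1 : ℂ) : ℕ → ℂ) k := by
    intro k
    have : x k = ∑ n ∈ s, (c n • unitVec n) k := by
      rw [hx]
      induction s using Finset.induction_on with
      | empty => simp
      | insert a t ha ih => simp [Finset.sum_insert ha, ih rfl]
    rw [this]; rfl
  have hx1 : ‖x‖ ≤ 1 := by
    rw [← ZeroAtInftyContinuousMap.norm_toBCF_eq_norm]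
    refine (BoundedContinuousFunction.norm_le zero_le_one).2 fun k => ?_
    change ‖x k‖ ≤ 1
    rw [hval]
    by_cases hk : k ∈ s
    · rw [Finset.sum_eq_single k]
      · simp [hc]
      · intro n _ hn; simp [hn.symm]
      · exact fun h => absurd hk h
    · rw [Finset.sum_eq_zero]
      · simp
      · intro n hn
        have : k ≠ n := fun h => hk (h ▸ hn)
        simp [this]
  have h1 : φ x = ((∑ n ∈ s, ‖φ (unitVec n)‖ : ℝ) : ℂ) := by
    rw [hx, map_sum, Complex.ofReal_sum]
    refine Finset.sum_congr rfl fun n _ => ?_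
    rw [_root_.map_smul, smul_eq_mul]
    exact (hcφ n).symm
  calc ∑ n ∈ s, ‖φ (unitVec n)‖ = ‖φ x‖ := by
        rw [h1, Complex.norm_real, Real.norm_of_nonneg (by positivity)]
    _ ≤ ‖φ‖ * ‖x‖ := φ.le_opNorm x
    _ ≤ ‖φ‖ := mul_le_of_le_one_right (norm_nonneg φ) hx1

theorem summable_norm_apply_unitVec (φ : StrongDual ℂ CZero) :
    Summable fun n => ‖φ (unitVec n)‖ :=
  summable_of_sum_le (fun _ => norm_nonneg _) (sum_norm_apply_unitVec_le φ)

theorem norm_mul_apply_unitVec_le (z : LInfty) (φ : StrongDual ℂ CZero) (n : ℕ) :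
    ‖z n * φ (unitVec n)‖ ≤ ‖z‖ * ‖φ (unitVec n)‖ := by
  rw [norm_mul]
  gcongr
  exact lp.norm_apply_le_norm ENNReal.top_ne_zero z n

theorem summable_mul_apply_unitVec (z : LInfty) (φ : StrongDual ℂ CZero) :
    Summable fun n => z n * φ (unitVec n) :=
  .of_norm_bounded ((summable_norm_apply_unitVec φ).mul_left ‖z‖) (norm_mul_apply_unitVec_le z φ)

/-- The canonical identification of `ℓ∞ = (ℓ₁)*` with the bidual of `c₀`: `z ∈ ℓ∞` acts on
`φ ∈ c₀* = ℓ₁` by `∑ zₙ φ(eₙ)`. -/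
def toBidual (z : LInfty) : Bidual CZero :=
  LinearMap.mkContinuous
    { toFun := fun φ => ∑' n, z n * φ (unitVec n)
      map_add' := fun φ χ => by
        rw [← (summable_mul_apply_unitVec z φ).tsum_add (summable_mul_apply_unitVec z χ)]
        simp [mul_add]
      map_smul' := fun c φ => by
        rw [RingHom.id_apply, smul_eq_mul, ← tsum_mul_left]
        simp [mul_left_comm] }
    ‖z‖ fun φ => by
      have hs := summable_norm_apply_unitVec φ
      calc ‖∑' n, z n * φ (unitVec n)‖ ≤ ∑' n, ‖z‖ * ‖φ (unitVec n)‖ :=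
            tsum_of_norm_bounded (hs.mul_left ‖z‖).hasSum (norm_mul_apply_unitVec_le z φ)
        _ = ‖z‖ * ∑' n, ‖φ (unitVec n)‖ := tsum_mul_left
        _ ≤ ‖z‖ * ‖φ‖ := by
          gcongr
          exact hs.tsum_le_of_sum_le (sum_norm_apply_unitVec_le φ)

theorem toBidual_apply (z : LInfty) (φ : StrongDual ℂ CZero) :
    toBidual z φ = ∑' n, z n * φ (unitVec n) := rfl

/-! ### The infinite polytorus and its Hardy spaces -/

instance : MeasurableSpace Circle := borel Circle

instance : BorelSpace Circle := ⟨rfl⟩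

/-- The infinite polytorus `𝕋^∞`. -/
abbrev Polytorus : Type := ℕ → Circle

/-- Normalized Lebesgue measure on `𝕋`: the image of the invariant probability on `ℝ/ℤ` under
`t ↦ exp (2πit)`. -/
def circleMeasure : Measure Circle :=
  (AddCircle.haarAddCircle (T := (1 : ℝ))).map AddCircle.toCircle

instance : IsProbabilityMeasure circleMeasure :=
  Measure.isProbabilityMeasure_map AddCircle.continuous_toCircle.aemeasurable

/-- The product of the normalized Lebesgue measures. -/
def polytorusMeasure : Measure Polytorus := Measure.infinitePi fun _ : ℕ => circleMeasure

instance : IsProbabilityMeasure polytorusMeasure :=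
  inferInstanceAs (IsProbabilityMeasure (Measure.infinitePi fun _ : ℕ => circleMeasure))

/-- A point of the polytorus, as a bounded sequence. -/
def Polytorus.toLInfty (w : Polytorus) : LInfty :=
  ⟨fun n => (w n : ℂ), memℓp_infty ⟨1, by rintro _ ⟨n, rfl⟩; exact (Circle.norm_coe _).le⟩⟩

/-- The monomial `w^α = ∏ wₙ^{αₙ}`, for a finitely supported `α` with integer entries. -/
def torusMonomial (α : ℕ →₀ ℤ) (w : Polytorus) : ℂ := α.prod fun n k => (w n : ℂ) ^ k

theorem continuous_torusMonomial (α : ℕ →₀ ℤ) : Continuous (torusMonomial α) := by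
  unfold torusMonomial Finsupp.prod
  refine continuous_finsetProd _ fun n _ => ?_
  exact (continuous_subtype_val.comp (continuous_apply n)).zpow₀ _ fun w => Or.inl (w n).coe_ne_zero

theorem norm_torusMonomial (α : ℕ →₀ ℤ) (w : Polytorus) : ‖torusMonomial α w‖ = 1 := by
  simp only [torusMonomial, Finsupp.prod, norm_prod, norm_zpow, Circle.norm_coe, one_zpow,
    Finset.prod_const_one]

/-- The Fourier coefficient `f̂(α) = ∫ f(w) w^{-α} dm(w)`. -/
def torusCoeff (f : Polytorus → ℂ) (α : ℕ →₀ ℤ) : ℂ :=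
  ∫ w, f w * torusMonomial (-α) w ∂polytorusMeasure

theorem torusCoeff_smul {p : ℝ≥0∞} (c : ℂ) (f : Lp ℂ p polytorusMeasure) (α : ℕ →₀ ℤ) :
    torusCoeff (c • f : Lp ℂ p polytorusMeasure) α = c * torusCoeff f α := by
  unfold torusCoeff
  rw [← integral_const_mul]
  refine integral_congr_ae ?_
  filter_upwards [Lp.coeFn_smul c f] with w hw
  rw [hw, Pi.smul_apply, smul_eq_mul, mul_assoc]

theorem torusCoeff_zero {p : ℝ≥0∞} (α : ℕ →₀ ℤ) : torusCoeff (0 : Lp ℂ p polytorusMeasure) α = 0 := by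
  simpa using torusCoeff_smul (p := p) 0 0 α

section Hardy

variable (p : ℝ≥0∞) [Fact (1 ≤ p)]

theorem integrable_mul_torusMonomial (f : Lp ℂ p polytorusMeasure) (α : ℕ →₀ ℤ) :
    Integrable (fun w => f w * torusMonomial α w) polytorusMeasure :=
  ((Lp.memLp f).integrable Fact.out).mul_bdd (c := 1)
    (continuous_torusMonomial α).aestronglyMeasurable (ae_of_all _ fun w => (norm_torusMonomial α w).le)

variable {p}

theorem torusCoeff_add (f g : Lp ℂ p polytorusMeasure) (α : ℕ →₀ ℤ) :
    torusCoeff (f + g : Lp ℂ p polytorusMeasure) α = torusCoeff f α + torusCoeff g α := by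
  unfold torusCoeff
  rw [← integral_add (integrable_mul_torusMonomial p f _) (integrable_mul_torusMonomial p g _)]
  refine integral_congr_ae ?_
  filter_upwards [Lp.coeFn_add f g] with w hw
  rw [hw, Pi.add_apply, add_mul]

variable (p)

/-- The Hardy space `H_p(𝕋^∞)`: the `f ∈ L_p(𝕋^∞)` with `f̂(α) = 0` whenever `α` has a negative
entry. -/
def hardy : Submodule ℂ (Lp ℂ p polytorusMeasure) where
  carrier := {f | ∀ α : ℕ →₀ ℤ, ¬ 0 ≤ α → torusCoeff f α = 0}
  zero_mem' := fun α _ => torusCoeff_zero α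
  add_mem' := fun {f g} hf hg α hα => by rw [torusCoeff_add, hf α hα, hg α hα, add_zero]
  smul_mem' := fun c f hf α hα => by rw [torusCoeff_smul, hf α hα, mul_zero]

/-- The homogeneous part `H_p^m(𝕋^∞)`: the `f ∈ H_p(𝕋^∞)` such that `f̂(α) ≠ 0` only if
`|α| = ∑ αₙ = m`. -/
def hardyHom (m : ℕ) : Submodule ℂ (Lp ℂ p polytorusMeasure) where
  carrier := {f | f ∈ hardy p ∧ ∀ α : ℕ →₀ ℤ, torusCoeff f α ≠ 0 → (α.sum fun _ k => k) = m}
  zero_mem' := ⟨zero_mem _, fun α h => absurd (torusCoeff_zero α) h⟩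
  add_mem' := fun {f g} hf hg => ⟨add_mem hf.1 hg.1, fun α h => by
    by_cases h1 : torusCoeff f α = 0
    · by_cases h2 : torusCoeff g α = 0
      · exact absurd (by rw [torusCoeff_add, h1, h2, add_zero]) h
      · exact hg.2 α h2
    · exact hf.2 α h1⟩
  smul_mem' := fun c f hf => ⟨Submodule.smul_mem _ c hf.1, fun α h =>
    hf.2 α fun h1 => h (by rw [torusCoeff_smul, h1, mul_zero])⟩

end Hardy

end AronBerner

end

/-!
Write `z = x + y`, with `x` the truncation of `z ∈ 𝕋^∞` to its first `N` coordinates and `y` the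
remaining tail. Multiplying the tail by `c ∈ 𝕋` makes the Arens extension a polynomial of degree at
most `m` in `c`, so averaging over the `(m + 1)`-st roots of unity removes all but its constant
term: the average of `AB(P)` is `w ↦ P (w₀, …, w_{N-1}, 0, …)`, a trigonometric polynomial. These
averages are contractions of `L_∞`, they fix the Fourier coefficients in the first `N` variables,
and they converge to the identity in `L_1` as `N → ∞`. The convergence gives
`‖AB(P)‖ ≤ ‖P‖` on `𝕋^∞`, and contractivity together with the maximum modulus principle on
polydiscs gives the reverse inequality.

Conversely, the averages of `f ∈ H_∞^m(𝕋^∞)` are the partial Fourier sums of `f`, hence these are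
bounded by `‖f‖_∞`. They come from polynomials on `c₀` of norm at most `‖f‖_∞`; by polarization
the associated symmetric forms are bounded too, and a limit along an ultrafilter is a preimage
of `f`.
-/

noncomputable section

namespace AronBerner

/-! ### Characters of the polytorus -/

instance : circleMeasure.IsMulLeftInvariant where
  map_mul_left_eq_self c := by
    obtain ⟨t, rfl⟩ := (AddCircle.homeomorphCircle (T := (1 : ℝ)) one_ne_zero).surjective c
    rw [AddCircle.homeomorphCircle_apply, circleMeasure,
      Measure.map_map (measurable_const_mul _) AddCircle.continuous_toCircle.measurable]
    have hcomp : ((fun x => AddCircle.toCircle t * x) ∘ AddCircle.toCircle (T := (1 : ℝ))) =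
        AddCircle.toCircle ∘ fun x => t + x :=
      funext fun x => (AddCircle.toCircle_add t x).symm
    rw [hcomp, ← Measure.map_map AddCircle.continuous_toCircle.measurable (measurable_const_add t),
      map_add_left_eq_self]

instance : polytorusMeasure.IsMulLeftInvariant where
  map_mul_left_eq_self c := by
    have h := Measure.infinitePi_map_pi (μ := fun _ : ℕ => circleMeasure)
      (f := fun n x => c n * x) (fun n => measurable_const_mul (c n))
    simp only [map_mul_left_eq_self] at h
    exact h

instance : polytorusMeasure.IsOpenPosMeasure :=
  isOpenPosMeasure_of_mulLeftInvariant_of_compact Set.univ isCompact_univ (by simp)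

theorem torusMonomial_mul (α : ℕ →₀ ℤ) (v w : Polytorus) :
    torusMonomial α (v * w) = torusMonomial α v * torusMonomial α w := by
  simp [torusMonomial, Finsupp.prod, mul_zpow, Finset.prod_mul_distrib]

theorem torusMonomial_add (α β : ℕ →₀ ℤ) (w : Polytorus) :
    torusMonomial (α + β) w = torusMonomial α w * torusMonomial β w :=
  Finsupp.prod_add_index' (fun _ => zpow_zero _) fun n _ _ => zpow_add₀ (w n).coe_ne_zero _ _

theorem torusMonomial_zero (w : Polytorus) : torusMonomial 0 w = 1 := Finsupp.prod_zero_index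

theorem torusMonomial_single (n : ℕ) (k : ℤ) (w : Polytorus) :
    torusMonomial (Finsupp.single n k) w = (w n : ℂ) ^ k :=
  Finsupp.prod_single_index (zpow_zero _)

theorem torusMonomial_neg (α : ℕ →₀ ℤ) (w : Polytorus) :
    torusMonomial (-α) w = star (torusMonomial α w) := by
  simp [torusMonomial, Finsupp.prod, ← Circle.coe_inv_eq_conj, Finsupp.support_neg]

theorem exists_circle_zpow_ne_one {k : ℤ} (hk : k ≠ 0) : ∃ c : Circle, (c : ℂ) ^ k ≠ 1 := by
  refine ⟨Circle.exp (Real.pi / k), fun h => ?_⟩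
  have hk' : (k : ℂ) ≠ 0 := by exact_mod_cast hk
  have hpi : (k : ℂ) * (((Real.pi / k : ℝ) : ℂ) * Complex.I) = Real.pi * Complex.I := by
    push_cast
    field_simp
  rw [Circle.coe_exp, ← Complex.exp_int_mul, hpi, Complex.exp_pi_mul_I] at h
  norm_num at h

theorem exists_torusMonomial_ne_one {α : ℕ →₀ ℤ} (hα : α ≠ 0) :
    ∃ c : Polytorus, torusMonomial α c ≠ 1 := by
  obtain ⟨n, hn⟩ := Finsupp.ne_iff.1 hα
  obtain ⟨c, hc⟩ := exists_circle_zpow_ne_one hn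
  refine ⟨Pi.mulSingle n c, ?_⟩
  rw [torusMonomial, Finsupp.prod, Finset.prod_eq_single n]
  · simpa using hc
  · intro k _ hk
    simp [Pi.mulSingle_eq_of_ne hk]
  · intro h
    exact absurd (Finsupp.notMem_support_iff.1 h) hn

theorem integral_torusMonomial (α : ℕ →₀ ℤ) :
    ∫ w, torusMonomial α w ∂polytorusMeasure = if α = 0 then 1 else 0 := by
  split_ifs with h
  · simp [h, torusMonomial_zero]
  · obtain ⟨c, hc⟩ := exists_torusMonomial_ne_one h
    have hinv := integral_mul_left_eq_self (μ := polytorusMeasure) (torusMonomial α) c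
    simp only [torusMonomial_mul, integral_const_mul] at hinv
    by_contra h0
    exact hc (mul_right_cancel₀ h0 (hinv.trans (one_mul _).symm))

theorem integrable_mul_torusMonomial_of_integrable {f : Polytorus → ℂ}
    (hf : Integrable f polytorusMeasure) (α : ℕ →₀ ℤ) :
    Integrable (fun w => f w * torusMonomial α w) polytorusMeasure :=
  hf.mul_bdd (c := 1) (continuous_torusMonomial α).aestronglyMeasurable
    (ae_of_all _ fun w => (norm_torusMonomial α w).le)

/-! ### Fourier coefficients -/

theorem torusCoeff_congr {f g : Polytorus → ℂ} (h : f =ᵐ[polytorusMeasure] g) (α : ℕ →₀ ℤ) :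
    torusCoeff f α = torusCoeff g α :=
  integral_congr_ae (h.mul (ae_eq_refl _))

theorem torusCoeff_const_mul (c : ℂ) (f : Polytorus → ℂ) (α : ℕ →₀ ℤ) :
    torusCoeff (fun w => c * f w) α = c * torusCoeff f α := by
  simp only [torusCoeff, mul_assoc, integral_const_mul]

theorem torusCoeff_sub {f g : Polytorus → ℂ} (hf : Integrable f polytorusMeasure)
    (hg : Integrable g polytorusMeasure) (α : ℕ →₀ ℤ) :
    torusCoeff (f - g) α = torusCoeff f α - torusCoeff g α := by
  simp only [torusCoeff, Pi.sub_apply, sub_mul]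
  exact integral_sub (integrable_mul_torusMonomial_of_integrable hf _)
    (integrable_mul_torusMonomial_of_integrable hg _)

theorem torusCoeff_finsetSum {ι : Type*} (s : Finset ι) {f : ι → Polytorus → ℂ}
    (hf : ∀ i ∈ s, Integrable (f i) polytorusMeasure) (α : ℕ →₀ ℤ) :
    torusCoeff (fun w => ∑ i ∈ s, f i w) α = ∑ i ∈ s, torusCoeff (f i) α := by
  simp only [torusCoeff, Finset.sum_mul]
  exact integral_finsetSum s fun i hi => integrable_mul_torusMonomial_of_integrable (hf i hi) _

theorem torusCoeff_torusMonomial (β α : ℕ →₀ ℤ) :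
    torusCoeff (torusMonomial β) α = if β = α then 1 else 0 := by
  simp only [torusCoeff, ← torusMonomial_add, integral_torusMonomial, ← sub_eq_add_neg,
    sub_eq_zero]

theorem integrable_torusMonomial (α : ℕ →₀ ℤ) :
    Integrable (torusMonomial α) polytorusMeasure :=
  .of_bound (continuous_torusMonomial α).aestronglyMeasurable 1
    (ae_of_all _ fun w => (norm_torusMonomial α w).le)

theorem torusCoeff_sum_mul_torusMonomial {ι : Type*} (s : Finset ι) (a : ι → ℂ)
    (β : ι → ℕ →₀ ℤ) (α : ℕ →₀ ℤ) :
    torusCoeff (fun w => ∑ i ∈ s, a i * torusMonomial (β i) w) α =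
      ∑ i ∈ s, if β i = α then a i else 0 := by
  rw [torusCoeff_finsetSum s fun i _ => (integrable_torusMonomial (β i)).const_mul (a i)]
  simp only [torusCoeff_const_mul, torusCoeff_torusMonomial, mul_ite, mul_one, mul_zero]

theorem torusCoeff_comp_mul_left (f : Polytorus → ℂ) (c : Polytorus) (α : ℕ →₀ ℤ) :
    torusCoeff (fun w => f (c * w)) α = torusMonomial α c * torusCoeff f α := by
  have hc : torusMonomial α c * torusMonomial (-α) c = 1 := by
    rw [← torusMonomial_add, add_neg_cancel, torusMonomial_zero]
  rw [torusCoeff, torusCoeff,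
    ← integral_mul_left_eq_self (fun w => f w * torusMonomial (-α) w) c, ← integral_const_mul]
  refine integral_congr_ae (ae_of_all _ fun w => ?_)
  simp only [torusMonomial_mul]
  linear_combination (-f (c * w) * torusMonomial (-α) w) * hc

theorem norm_torusCoeff_le {f : Polytorus → ℂ} {C : ℝ} (hf : ∀ w, ‖f w‖ ≤ C) (α : ℕ →₀ ℤ) :
    ‖torusCoeff f α‖ ≤ C := by
  simpa [torusCoeff] using norm_integral_le_of_norm_le_const (μ := polytorusMeasure)
    (f := fun w => f w * torusMonomial (-α) w) (C := C)
    (ae_of_all _ fun w => by rw [norm_mul, norm_torusMonomial, mul_one]; exact hf w)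

/-- The characters of `𝕋^∞` as a homomorphism from `ℤ^(ℕ)`, written multiplicatively, to the
continuous functions; its range spans the algebra of trigonometric polynomials. -/
def monomialMap : Multiplicative (ℕ →₀ ℤ) →* C(Polytorus, ℂ) where
  toFun α := ⟨torusMonomial α.toAdd, continuous_torusMonomial α.toAdd⟩
  map_one' := ContinuousMap.ext torusMonomial_zero
  map_mul' α β := ContinuousMap.ext (torusMonomial_add α.toAdd β.toAdd)

theorem star_monomialMap (α : Multiplicative (ℕ →₀ ℤ)) :
    star (monomialMap α) = monomialMap α⁻¹ :=
  ContinuousMap.ext fun w => (torusMonomial_neg α.toAdd w).symm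

theorem star_range_monomialMap : star (Set.range monomialMap) = Set.range monomialMap := by
  have hsub : star (Set.range monomialMap) ⊆ Set.range monomialMap := by
    rintro f ⟨α, hα⟩
    exact ⟨α⁻¹, by rw [← star_monomialMap, hα, star_star]⟩
  exact hsub.antisymm (Set.star_subset_star.1 (by rwa [star_star]))

theorem separatesPoints_adjoin_monomialMap :
    (StarAlgebra.adjoin ℂ (Set.range monomialMap)).SeparatesPoints := by
  intro v w hvw
  obtain ⟨n, hn⟩ := Function.ne_iff.1 hvw
  refine ⟨_, ⟨_, StarAlgebra.subset_adjoin ℂ _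
    ⟨Multiplicative.ofAdd (Finsupp.single n 1), rfl⟩, rfl⟩, ?_⟩
  simpa [monomialMap, torusMonomial_single, Circle.coe_inj] using hn

theorem dense_span_range_monomialMap :
    Dense (Submodule.span ℂ (Set.range monomialMap) : Set C(Polytorus, ℂ)) := by
  have hspan : (StarAlgebra.adjoin ℂ (Set.range monomialMap)).toSubalgebra.toSubmodule =
      Submodule.span ℂ (Set.range monomialMap) := by
    rw [StarAlgebra.adjoin_toSubalgebra, star_range_monomialMap, Set.union_self,
      Algebra.adjoin_eq_span, ← MonoidHom.coe_mrange, Submonoid.closure_eq]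
  have htop := ContinuousMap.starSubalgebra_topologicalClosure_eq_top_of_separatesPoints _
    separatesPoints_adjoin_monomialMap
  rw [← hspan, dense_iff_closure_eq]
  exact congrArg (SetLike.coe : StarSubalgebra ℂ C(Polytorus, ℂ) → Set _) htop

theorem ae_eq_zero_of_torusCoeff_eq_zero {f : Polytorus → ℂ} (hf : MemLp f 2 polytorusMeasure)
    (h : ∀ α, torusCoeff f α = 0) : f =ᵐ[polytorusMeasure] 0 := by
  let ofCont : C(Polytorus, ℂ) →L[ℂ] Lp ℂ 2 polytorusMeasure :=
    ContinuousMap.toLp 2 polytorusMeasure ℂ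
  have hperp : innerSL ℂ (hf.toLp f) ∘L ofCont = 0 := by
    refine ContinuousLinearMap.ext_on dense_span_range_monomialMap ?_
    rintro _ ⟨α, rfl⟩
    suffices inner ℂ (ofCont (monomialMap α)) (hf.toLp f) = torusCoeff f α.toAdd by
      simpa [h] using congrArg star this
    rw [L2.inner_def, torusCoeff]
    refine integral_congr_ae ?_
    filter_upwards [hf.coeFn_toLp, ContinuousMap.coeFn_toLp (p := 2) (𝕜 := ℂ) polytorusMeasure
      (monomialMap α)] with w hfw hαw
    rw [hfw, hαw, torusMonomial_neg]
    rfl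
  have hzero : hf.toLp f = 0 :=
    (ContinuousMap.toLp_denseRange ℂ polytorusMeasure ℂ
      (ENNReal.ofNat_ne_top (n := 2))).eq_zero_of_inner_left ℂ fun g => DFunLike.congr_fun hperp g
  exact hf.coeFn_toLp.symm.trans (hzero ▸ Lp.coeFn_zero ℂ 2 polytorusMeasure)

theorem ae_eq_of_torusCoeff_eq {f g : Polytorus → ℂ} (hf : MemLp f 2 polytorusMeasure)
    (hg : MemLp g 2 polytorusMeasure) (h : ∀ α, torusCoeff f α = torusCoeff g α) :
    f =ᵐ[polytorusMeasure] g := by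
  refine sub_ae_eq_zero _ _ |>.1 (ae_eq_zero_of_torusCoeff_eq_zero (hf.sub hg) fun α => ?_)
  rw [torusCoeff_sub (hf.integrable one_le_two) (hg.integrable one_le_two), h, sub_self]

/-! ### Averages over rotations of the tail -/

theorem tendsto_eLpNorm_comp_mul_left_sub {G E ι : Type*} [Group G] [TopologicalSpace G]
    [IsTopologicalGroup G] [MeasurableSpace G] [BorelSpace G] {μ : Measure G}
    [μ.IsMulLeftInvariant] [μ.InnerRegularCompactLTTop] [IsLocallyFiniteMeasure μ]
    [NormedAddCommGroup E] {p : ℝ≥0∞} [Fact (1 ≤ p)] (hp : p ≠ ∞) {f : G → E}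
    (hf : MemLp f p μ) {l : Filter ι} {c : ι → G} (hc : Tendsto c l (𝓝 1)) :
    Tendsto (fun i => eLpNorm ((fun x => f (c i * x)) - f) p μ) l (𝓝 0) := by
  let mulLeft : C(G, C(G, G)) := ContinuousMap.curry ⟨fun x => x.1 * x.2, continuous_mul⟩
  have hpres (a : G) : MeasurePreserving (mulLeft a) μ μ := measurePreserving_mul_left μ a
  have hlim : Tendsto (fun i => Lp.compMeasurePreserving (mulLeft (c i)) (hpres _) (hf.toLp f)) l
      (𝓝 (Lp.compMeasurePreserving (mulLeft 1) (hpres 1) (hf.toLp f))) :=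
    tendsto_const_nhds.compMeasurePreservingLp ((mulLeft.continuous.tendsto 1).comp hc)
      (fun i => hpres (c i)) (hpres 1) hp
  refine ((Lp.tendsto_Lp_iff_tendsto_eLpNorm' _ _).1 hlim).congr fun i => eLpNorm_congr_ae ?_
  have htoLp (a : G) :
      Lp.compMeasurePreserving (mulLeft a) (hpres a) (hf.toLp f) =ᵐ[μ] fun x => f (a * x) :=
    (Lp.coeFn_compMeasurePreserving _ (hpres a)).trans
      ((hpres a).quasiMeasurePreserving.ae_eq_comp hf.coeFn_toLp)
  filter_upwards [htoLp (c i), htoLp 1] with x hci h1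
  simp only [Pi.sub_apply, hci, h1, one_mul]

/-- The primitive root of unity `exp (2πi / (m + 1))`, as a point of the circle. -/
def circleRoot (m : ℕ) : Circle := Circle.exp (2 * Real.pi / (m + 1 : ℕ))

theorem isPrimitiveRoot_circleRoot (m : ℕ) : IsPrimitiveRoot (circleRoot m : ℂ) (m + 1) := by
  convert! Complex.isPrimitiveRoot_exp (m + 1) m.succ_ne_zero using 1
  rw [circleRoot, Circle.coe_exp]
  push_cast
  ring_nf

theorem sum_circleRoot_pow {m k : ℕ} (hk : k ≤ m) :
    ∑ j ∈ Finset.range (m + 1), ((circleRoot m : ℂ) ^ j) ^ k =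
      if k = 0 then (m + 1 : ℂ) else 0 := by
  split_ifs with h
  · simp [h]
  · have hroot := isPrimitiveRoot_circleRoot m
    have hne : (circleRoot m : ℂ) ^ k ≠ 1 := hroot.pow_ne_one_of_pos_of_lt h (by omega)
    simp only [pow_right_comm _ _ k]
    rw [geom_sum_eq hne, pow_right_comm, hroot.pow_eq_one]
    simp

/-- The point `(1, …, 1, c, c, …)` of the polytorus, with `N` entries `1`. -/
def tailRot (N : ℕ) (c : Circle) : Polytorus := fun n => if n < N then 1 else c

theorem tendsto_tailRot (c : Circle) : Tendsto (fun N => tailRot N c) atTop (𝓝 1) :=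
  tendsto_pi_nhds.2 fun n => tendsto_const_nhds.congr' <| by
    filter_upwards [eventually_gt_atTop n] with N hN
    simp [tailRot, hN]

theorem torusMonomial_tailRot_of_support {α : ℕ →₀ ℤ} {N : ℕ} (h : α.support ⊆ Finset.range N)
    (c : Circle) : torusMonomial α (tailRot N c) = 1 :=
  Finset.prod_eq_one fun n hn => by simp [tailRot, Finset.mem_range.1 (h hn)]

/-- The average of `f` over the rotations of the coordinates `n ≥ N` by the roots of unity of order
`m + 1`. On functions which are `m`-homogeneous it retains the part depending on the first `N`
coordinates only. -/
def tailMean (m N : ℕ) (f : Polytorus → ℂ) (w : Polytorus) : ℂ :=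
  (m + 1 : ℂ)⁻¹ * ∑ j ∈ Finset.range (m + 1), f (tailRot N (circleRoot m ^ j) * w)

section TailMean

variable {m N : ℕ} {f g : Polytorus → ℂ} {C : ℝ}

theorem torusCoeff_tailMean (hf : Integrable f polytorusMeasure) (α : ℕ →₀ ℤ) :
    torusCoeff (tailMean m N f) α =
      (m + 1 : ℂ)⁻¹ * (∑ j ∈ Finset.range (m + 1), torusMonomial α (tailRot N (circleRoot m ^ j))) *
        torusCoeff f α := by
  unfold tailMean
  rw [torusCoeff_const_mul, torusCoeff_finsetSum _ fun j _ => hf.comp_mul_left _]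
  simp only [torusCoeff_comp_mul_left, Finset.sum_mul, mul_assoc]

theorem torusCoeff_tailMean_of_support (hf : Integrable f polytorusMeasure) {α : ℕ →₀ ℤ}
    (h : α.support ⊆ Finset.range N) : torusCoeff (tailMean m N f) α = torusCoeff f α := by
  have hm : (m + 1 : ℂ) ≠ 0 := m.cast_add_one_ne_zero
  simp [torusCoeff_tailMean hf, torusMonomial_tailRot_of_support h, hm]

theorem memLp_tailMean {p : ℝ≥0∞} (hf : MemLp f p polytorusMeasure) (m N : ℕ) :
    MemLp (tailMean m N f) p polytorusMeasure :=
  (memLp_finsetSum _ fun j _ => hf.comp_measurePreserving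
    (measurePreserving_mul_left polytorusMeasure (tailRot N (circleRoot m ^ j)))).const_mul _

theorem ae_eq_of_tailMean_ae_eq (hf : MemLp f 2 polytorusMeasure)
    (hg : MemLp g 2 polytorusMeasure)
    (h : ∀ N, tailMean m N f =ᵐ[polytorusMeasure] tailMean m N g) : f =ᵐ[polytorusMeasure] g := by
  refine ae_eq_of_torusCoeff_eq hf hg fun α => ?_
  obtain ⟨N, hN⟩ := α.support.exists_nat_subset_range
  rw [← torusCoeff_tailMean_of_support (m := m) (hf.integrable one_le_two) hN,
    ← torusCoeff_tailMean_of_support (m := m) (hg.integrable one_le_two) hN,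
    torusCoeff_congr (h N)]

theorem ae_norm_tailMean_le (h : ∀ᵐ w ∂polytorusMeasure, ‖f w‖ ≤ C) :
    ∀ᵐ w ∂polytorusMeasure, ‖tailMean m N f w‖ ≤ C := by
  have hrot (j : ℕ) := (measurePreserving_mul_left polytorusMeasure
    (tailRot N (circleRoot m ^ j))).quasiMeasurePreserving.ae h
  filter_upwards [ae_all_iff.2 hrot] with w hw
  have hsum := norm_sum_le_of_le (Finset.range (m + 1)) fun j _ => hw j
  rw [Finset.sum_const, Finset.card_range, nsmul_eq_mul] at hsum
  rw [tailMean, norm_mul, norm_inv, ← Nat.cast_succ, Complex.norm_natCast]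
  exact (inv_mul_le_iff₀ (by positivity)).2 hsum

theorem tendsto_eLpNorm_tailMean_sub {p : ℝ≥0∞} [Fact (1 ≤ p)] (hp : p ≠ ∞)
    (hf : MemLp f p polytorusMeasure) :
    Tendsto (fun N => eLpNorm (tailMean m N f - f) p polytorusMeasure) atTop (𝓝 0) := by
  let err (N j : ℕ) : Polytorus → ℂ := (fun w => f (tailRot N (circleRoot m ^ j) * w)) - f
  have herr : ∀ N j, AEStronglyMeasurable (err N j) polytorusMeasure := fun N j =>
    (hf.1.comp_measurePreserving (measurePreserving_mul_left _ _)).sub hf.1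
  have hmean : ∀ N, tailMean m N f - f =
      (m + 1 : ℂ)⁻¹ • ∑ j ∈ Finset.range (m + 1), err N j := fun N => by
    ext w
    have hm : (m + 1 : ℂ) ≠ 0 := m.cast_add_one_ne_zero
    simp only [tailMean, err, Pi.sub_apply, Pi.smul_apply, Finset.sum_apply, Finset.sum_sub_distrib,
      Finset.sum_const, Finset.card_range, nsmul_eq_mul, smul_eq_mul, Pi.mul_apply,
      Pi.natCast_apply]
    push_cast
    field_simp
  have hlim : Tendsto (fun N => ‖(m + 1 : ℂ)⁻¹‖ₑ *
      ∑ j ∈ Finset.range (m + 1), eLpNorm (err N j) p polytorusMeasure) atTop (𝓝 0) := by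
    have hsum := tendsto_finsetSum (Finset.range (m + 1)) fun j _ =>
      tendsto_eLpNorm_comp_mul_left_sub hp hf (tendsto_tailRot (circleRoot m ^ j))
    simpa using ENNReal.Tendsto.const_mul hsum (Or.inr enorm_ne_top)
  refine tendsto_of_tendsto_of_tendsto_of_le_of_le tendsto_const_nhds hlim (fun _ => zero_le)
    fun N => ?_
  rw [hmean, eLpNorm_const_smul]
  gcongr
  exact eLpNorm_sum_le (fun j _ => herr N j) Fact.out

theorem ae_norm_le_of_ae_norm_tailMean_le (hf : Integrable f polytorusMeasure)
    (h : ∀ N, ∀ᵐ w ∂polytorusMeasure, ‖tailMean m N f w‖ ≤ C) :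
    ∀ᵐ w ∂polytorusMeasure, ‖f w‖ ≤ C := by
  have hf1 : MemLp f 1 polytorusMeasure := memLp_one_iff_integrable.2 hf
  obtain ⟨N, -, hN⟩ := (tendstoInMeasure_of_tendsto_eLpNorm one_ne_zero
    (fun N => (memLp_tailMean hf1 m N).1) hf.1
    (tendsto_eLpNorm_tailMean_sub ENNReal.one_ne_top hf1)).exists_seq_tendsto_ae
  filter_upwards [hN, ae_all_iff.2 h] with w hlim hle
  exact le_of_tendsto hlim.norm (.of_forall fun i => hle (N i))

end TailMean

/-! ### Homogeneous multi-indices -/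

section MultiIndex

/-- The multi-index of the monomial `∏ j, w (r j)`, with integer entries as in `torusMonomial`. -/
def multiIndex {ι : Type*} [Fintype ι] (r : ι → ℕ) : ℕ →₀ ℤ := ∑ j, Finsupp.single (r j) 1

variable {ι : Type*} [Fintype ι]

theorem multiIndex_apply (r : ι → ℕ) (n : ℕ) :
    multiIndex r n = Finset.card {j | r j = n} := by
  simp [multiIndex, Finsupp.finsetSum_apply, Finsupp.single_apply]

theorem multiIndex_nonneg (r : ι → ℕ) : 0 ≤ multiIndex r := fun n => by
  simp [multiIndex_apply]

theorem sum_multiIndex (r : ι → ℕ) : ((multiIndex r).sum fun _ k => k) = Fintype.card ι := by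
  rw [multiIndex, ← Finsupp.sum_finsetSum_index (fun _ => rfl) fun _ _ _ => rfl]
  simp

theorem mem_support_multiIndex {r : ι → ℕ} {n : ℕ} :
    n ∈ (multiIndex r).support ↔ ∃ j, r j = n := by
  simp [multiIndex_apply, Finset.filter_eq_empty_iff]

theorem torusMonomial_multiIndex (r : ι → ℕ) (w : Polytorus) :
    torusMonomial (multiIndex r) w = ∏ j, (w (r j) : ℂ) := by
  rw [multiIndex, torusMonomial, ← Finsupp.prod_finsetSum_index (fun _ => zpow_zero _)
    fun n _ _ => zpow_add₀ (w n).coe_ne_zero _ _]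
  simp

theorem torusMonomial_multiIndex_tailRot (r : ι → ℕ) (N : ℕ) (c : Circle) :
    torusMonomial (multiIndex r) (tailRot N c) = (c : ℂ) ^ Finset.card {j | N ≤ r j} := by
  have hval (j : ι) : (tailRot N c (r j) : ℂ) = if N ≤ r j then (c : ℂ) else 1 := by
    simp only [tailRot, ← not_lt]
    split_ifs <;> simp_all
  simp [torusMonomial_multiIndex, hval, Finset.prod_ite]

variable {m : ℕ}

theorem multiIndex_cons (n : ℕ) (r : Fin m → ℕ) :
    multiIndex (Fin.cons n r : Fin (m + 1) → ℕ) = Finsupp.single n 1 + multiIndex r := by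
  simp [multiIndex, Fin.sum_univ_succ]

theorem exists_multiIndex_eq {α : ℕ →₀ ℤ} (h0 : 0 ≤ α) (hsum : (α.sum fun _ k => k) = m) :
    ∃ r : Fin m → ℕ, multiIndex r = α := by
  induction m generalizing α with
  | zero =>
    have hα : ∀ n ∈ α.support, α n = 0 :=
      (Finset.sum_eq_zero_iff_of_nonneg fun n _ => h0 n).1 hsum
    have hα0 : α = 0 := by
      ext n
      by_contra hn
      exact hn (hα n (Finsupp.mem_support_iff.2 hn))
    exact ⟨Fin.elim0, by simp [multiIndex, hα0]⟩
  | succ m ih =>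
    obtain ⟨n, hn⟩ : ∃ n, α n ≠ 0 := by
      by_contra! h
      obtain rfl : α = 0 := Finsupp.ext h
      rw [Finsupp.sum_zero_index] at hsum
      omega
    have hpos : 0 ≤ α - Finsupp.single n 1 := fun k => by
      have hk : 0 ≤ α k := h0 k
      have hn1 : 1 ≤ α n := (h0 n).lt_of_ne' hn
      rcases eq_or_ne n k with rfl | hnk
      · simpa using hn1
      · simpa [Finsupp.single_apply, hnk] using hk
    have hsum' : ((α - Finsupp.single n 1).sum fun _ k => k) = (m : ℤ) := by
      rw [Finsupp.sum_sub_index fun _ _ _ => rfl, hsum]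
      simp
    obtain ⟨r, hr⟩ := ih hpos hsum'
    exact ⟨Fin.cons n r, by rw [multiIndex_cons, hr, add_sub_cancel]⟩

/-- The multi-indices of order `m` supported in the first `N` variables. -/
def homIndices (m N : ℕ) : Finset (ℕ →₀ ℤ) :=
  (Fintype.piFinset fun _ : Fin m => Finset.range N).image multiIndex

theorem multiIndex_mem_homIndices {r : Fin m → ℕ} {N : ℕ} :
    multiIndex r ∈ homIndices m N ↔ ∀ j, r j < N := by
  refine ⟨fun h j => ?_, fun h => Finset.mem_image_of_mem _ (by simpa using h)⟩
  obtain ⟨s, hs, hsr⟩ := Finset.mem_image.1 h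
  obtain ⟨i, hi⟩ : ∃ i, s i = r j := by
    rw [← mem_support_multiIndex, hsr]
    exact mem_support_multiIndex.2 ⟨j, rfl⟩
  rw [← hi]
  exact Finset.mem_range.1 (Fintype.mem_piFinset.1 hs i)

theorem exists_multiIndex_eq_of_mem_homIndices {α : ℕ →₀ ℤ} {N : ℕ} (h : α ∈ homIndices m N) :
    ∃ r : Fin m → ℕ, multiIndex r = α :=
  let ⟨r, _, hr⟩ := Finset.mem_image.1 h
  ⟨r, hr⟩

theorem homIndices_inter (m M N : ℕ) :
    homIndices m M ∩ homIndices m N = homIndices m (min M N) := by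
  ext α
  by_cases h : ∃ r : Fin m → ℕ, multiIndex r = α
  · obtain ⟨r, rfl⟩ := h
    simp [multiIndex_mem_homIndices, forall_and]
  · exact iff_of_false (fun hα => h (exists_multiIndex_eq_of_mem_homIndices
      (Finset.mem_inter.1 hα).1)) fun hα => h (exists_multiIndex_eq_of_mem_homIndices hα)

theorem torusCoeff_tailMean_multiIndex {f : Polytorus → ℂ} (hf : Integrable f polytorusMeasure)
    (r : Fin m → ℕ) (N : ℕ) : torusCoeff (tailMean m N f) (multiIndex r) =
      if ∀ j, r j < N then torusCoeff f (multiIndex r) else 0 := by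
  have hcard : Finset.card {j | N ≤ r j} = 0 ↔ ∀ j, r j < N := by
    simp [Finset.filter_eq_empty_iff]
  have hm : (m + 1 : ℂ) ≠ 0 := m.cast_add_one_ne_zero
  simp only [torusCoeff_tailMean hf, torusMonomial_multiIndex_tailRot, Circle.coe_pow,
    sum_circleRoot_pow (card_finset_fin_le _), hcard]
  split_ifs <;> simp [hm]

end MultiIndex

/-! ### Polarization -/

section Polarization

variable {m : ℕ} {X : Type*} [NormedAddCommGroup X] [NormedSpace ℂ X]

theorem form_sum_torus_smul {ι : Type*} (A : Form m X) (s : Finset ι) (e : ι → ℕ) (v : ι → X)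
    (w : Polytorus) : (A fun _ => ∑ i ∈ s, (w (e i) : ℂ) • v i) =
      ∑ r ∈ Fintype.piFinset fun _ : Fin m => s,
        A (v ∘ r) * torusMonomial (multiIndex (e ∘ r)) w := by
  classical
  rw [A.map_sum_finset]
  refine Finset.sum_congr rfl fun r _ => ?_
  rw [A.map_smul_univ, torusMonomial_multiIndex, smul_eq_mul, mul_comm]
  rfl

theorem bijective_of_multiIndex_eq {r : Fin m → Fin m}
    (h : multiIndex (Fin.val ∘ r) = multiIndex (Fin.val : Fin m → ℕ)) : Function.Bijective r := by
  refine Finite.surjective_iff_bijective.1 fun i => ?_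
  obtain ⟨j, hj⟩ : ∃ j, (Fin.val ∘ r) j = i := by
    rw [← mem_support_multiIndex, h]
    exact mem_support_multiIndex.2 ⟨i, rfl⟩
  exact ⟨j, Fin.ext hj⟩

theorem IsSymm.exists_torusCoeff_eq {A : Form m X} (hA : IsSymm A) (v : Fin m → X) :
    ∃ k : ℕ, 1 ≤ k ∧
      torusCoeff (fun w => A fun _ => ∑ i : Fin m, (w i : ℂ) • v i)
        (multiIndex (Fin.val : Fin m → ℕ)) = k * A v := by
  let s : Finset (Fin m → Fin m) :=
    {r | multiIndex (Fin.val ∘ r) = multiIndex (Fin.val : Fin m → ℕ)}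
  refine ⟨s.card, Finset.card_pos.2 ⟨id, by simp [s]⟩, ?_⟩
  have hperm : ∀ r ∈ s, A (v ∘ r) = A v := fun r hr =>
    hA (.ofBijective r (bijective_of_multiIndex_eq (by simpa [s] using hr))) v
  simp only [form_sum_torus_smul, torusCoeff_sum_mul_torusMonomial, Fintype.piFinset_univ]
  rw [← Finset.sum_filter, Finset.sum_congr rfl hperm, Finset.sum_const, nsmul_eq_mul]

theorem exists_norm_le_one_norm_smul_eq (x : X) : ∃ y : X, ‖y‖ ≤ 1 ∧ (‖x‖ : ℂ) • y = x := by
  refine ⟨(‖x‖ : ℂ)⁻¹ • x, ?_, ?_⟩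
  · rw [norm_smul, norm_inv, Complex.norm_real, norm_norm]
    exact inv_mul_le_one
  · rcases eq_or_ne x 0 with rfl | hx
    · simp
    · exact smul_inv_smul₀ (by simpa using hx) x

theorem HomPoly.norm_apply_le_mul_norm_pow (P : HomPoly m X) (x : X) :
    ‖P x‖ ≤ ‖P‖ * ‖x‖ ^ m := by
  obtain ⟨y, hy, hx⟩ := exists_norm_le_one_norm_smul_eq x
  calc ‖P x‖ = ‖x‖ ^ m * ‖P y‖ := by
        rw [← hx, P.map_smul, hx, norm_mul, norm_pow, Complex.norm_real, norm_norm]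
    _ ≤ ‖x‖ ^ m * ‖P‖ := by gcongr; exact P.norm_apply_le hy
    _ = ‖P‖ * ‖x‖ ^ m := mul_comm _ _

theorem HomPoly.norm_symmForm_apply_le_of_norm_le_one (P : HomPoly m X) {v : Fin m → X}
    (hv : ∀ i, ‖v i‖ ≤ 1) : ‖P.symmForm v‖ ≤ m ^ m * ‖P‖ := by
  obtain ⟨k, hk, hcoeff⟩ := IsSymm.exists_torusCoeff_eq P.symmForm_isSymm v
  have hsum (w : Polytorus) : ‖∑ i : Fin m, (w i : ℂ) • v i‖ ≤ m := by
    have hterm (i : Fin m) : ‖(w i : ℂ) • v i‖ ≤ 1 := by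
      rw [norm_smul, Circle.norm_coe, one_mul]
      exact hv i
    simpa using norm_sum_le_of_le Finset.univ fun i _ => hterm i
  have hbound (w : Polytorus) :
      ‖P.symmForm fun _ => ∑ i : Fin m, (w i : ℂ) • v i‖ ≤ m ^ m * ‖P‖ := by
    rw [← P.symmForm_diag, mul_comm]
    exact (P.norm_apply_le_mul_norm_pow _).trans (by gcongr; exact hsum w)
  calc ‖P.symmForm v‖ ≤ k * ‖P.symmForm v‖ :=
        le_mul_of_one_le_left (norm_nonneg _) (by exact_mod_cast hk)
    _ = ‖(k : ℂ) * P.symmForm v‖ := by rw [norm_mul, Complex.norm_natCast]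
    _ ≤ m ^ m * ‖P‖ := hcoeff ▸ norm_torusCoeff_le hbound _

theorem HomPoly.norm_symmForm_le (P : HomPoly m X) : ‖P.symmForm‖ ≤ m ^ m * ‖P‖ := by
  refine ContinuousMultilinearMap.opNorm_le_bound (by positivity) fun v => ?_
  choose y hy hv using fun i => exists_norm_le_one_norm_smul_eq (v i)
  calc ‖P.symmForm v‖ = (∏ i, ‖v i‖) * ‖P.symmForm y‖ := by
        conv_lhs => rw [← funext hv, P.symmForm.map_smul_univ]
        simp
    _ ≤ (∏ i, ‖v i‖) * (m ^ m * ‖P‖) := by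
        gcongr
        exact P.norm_symmForm_apply_le_of_norm_le_one hy
    _ = m ^ m * ‖P‖ * ∏ i, ‖v i‖ := mul_comm _ _

end Polarization

/-! ### Compactness -/

section Compactness

variable {m : ℕ} {X : Type*} [NormedAddCommGroup X] [NormedSpace ℂ X]

theorem exists_form_tendsto_ultrafilter {ι : Type*} (U : Ultrafilter ι) {A : ι → Form m X} {C : ℝ}
    (hA : ∀ i, ‖A i‖ ≤ C) : ∃ B : Form m X, ∀ v, Tendsto (fun i => A i v) U (𝓝 (B v)) := by
  have hbound : ∀ i v, ‖A i v‖ ≤ C * ∏ j, ‖v j‖ := fun i v => (A i).le_of_opNorm_le (hA i) v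
  have hex : ∀ v, ∃ l, Tendsto (fun i => A i v) U (𝓝 l) := fun v => by
    obtain ⟨l, -, hl⟩ := (isCompact_closedBall (0 : ℂ) (C * ∏ j, ‖v j‖)).ultrafilter_le_nhds
      (U.map fun i => A i v) <| tendsto_principal.2 <|
        Eventually.of_forall fun i => mem_closedBall_zero_iff.2 (hbound i v)
    exact ⟨l, hl⟩
  choose L hL using hex
  let B : MultilinearMap ℂ (fun _ : Fin m => X) ℂ :=
    { toFun := L
      map_update_add' := fun v j x y => by
        refine tendsto_nhds_unique (hL _) ?_
        simpa only [ContinuousMultilinearMap.map_update_add] using (hL _).add (hL _)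
      map_update_smul' := fun v j c x => by
        refine tendsto_nhds_unique (hL _) ?_
        simpa only [ContinuousMultilinearMap.map_update_smul] using (hL _).const_smul c }
  exact ⟨B.mkContinuous C fun v =>
    le_of_tendsto (hL v).norm (Eventually.of_forall fun i => hbound i v), hL⟩

theorem HomPoly.exists_tendsto_ultrafilter {ι : Type*} (U : Ultrafilter ι) {P : ι → HomPoly m X}
    {C : ℝ} (hP : ∀ i, ‖P i‖ ≤ C) :
    ∃ Q : HomPoly m X, ∀ x, Tendsto (fun i => P i x) U (𝓝 (Q x)) := by
  have hform : ∀ i, ‖(P i).symmForm‖ ≤ m ^ m * C := fun i =>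
    (P i).norm_symmForm_le.trans (by gcongr; exact hP i)
  obtain ⟨B, hB⟩ := exists_form_tendsto_ultrafilter U hform
  refine ⟨⟨fun x => B fun _ => x, B, fun _ => rfl⟩, fun x => ?_⟩
  exact (hB fun _ => x).congr fun i => ((P i).symmForm_diag x).symm

end Compactness

/-! ### The maximum modulus principle on polydiscs -/

section MaximumModulus

variable {F : Type*} [NormedAddCommGroup F] [NormedSpace ℂ F]

theorem norm_le_of_norm_le_on_sphere {f : ℂ → F} (hf : Differentiable ℂ f) {C : ℝ}
    (h : ∀ t : ℂ, ‖t‖ = 1 → ‖f t‖ ≤ C) {t : ℂ} (ht : ‖t‖ ≤ 1) : ‖f t‖ ≤ C := by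
  refine Complex.norm_le_of_forall_mem_frontier_norm_le (Metric.isBounded_ball (x := (0 : ℂ))
    (r := 1)) hf.diffContOnCl (fun s hs => h s ?_) ?_
  · rwa [frontier_ball _ one_ne_zero, mem_sphere_zero_iff_norm] at hs
  · rwa [closure_ball _ one_ne_zero, mem_closedBall_zero_iff]

theorem norm_le_of_norm_le_on_torus {ι : Type*} [Finite ι] {f : (ι → ℂ) → F}
    (hf : Differentiable ℂ f) {C : ℝ} (h : ∀ z, (∀ i, ‖z i‖ = 1) → ‖f z‖ ≤ C) {z : ι → ℂ}
    (hz : ∀ i, ‖z i‖ ≤ 1) : ‖f z‖ ≤ C := by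
  classical
  cases nonempty_fintype ι
  have hstep (s : Finset ι) : ∀ z : ι → ℂ, (∀ i ∈ s, ‖z i‖ ≤ 1) → (∀ i ∉ s, ‖z i‖ = 1) →
      ‖f z‖ ≤ C := by
    induction s using Finset.induction_on with
    | empty => exact fun z _ hz => h z fun i => hz i (Finset.notMem_empty i)
    | insert k s hk ih =>
      intro z hle heq
      have hdiff : Differentiable ℂ fun t : ℂ => f (Function.update z k t) :=
        hf.comp fun t => (hasFDerivAt_update z t).differentiableAt
      rw [← Function.update_eq_self k z]
      refine norm_le_of_norm_le_on_sphere hdiff (fun t ht => ih _ (fun i hi => ?_) fun i hi => ?_)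
        (hle k (Finset.mem_insert_self k s))
      · rw [Function.update_of_ne (ne_of_mem_of_not_mem hi hk)]
        exact hle i (Finset.mem_insert_of_mem hi)
      · rcases eq_or_ne i k with rfl | hik
        · rwa [Function.update_self]
        · rw [Function.update_of_ne hik]
          exact heq i (by simp [hik, hi])
  exact hstep Finset.univ z (fun i _ => hz i) fun i hi => absurd (Finset.mem_univ i) hi

end MaximumModulus

/-! ### Truncations -/

theorem CZero.norm_le {x : CZero} {C : ℝ} (hC : 0 ≤ C) : ‖x‖ ≤ C ↔ ∀ n, ‖x n‖ ≤ C := by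
  rw [← ZeroAtInftyContinuousMap.norm_toBCF_eq_norm, BoundedContinuousFunction.norm_le hC]
  rfl

theorem CZero.norm_apply_le (x : CZero) (n : ℕ) : ‖x n‖ ≤ ‖x‖ :=
  (CZero.norm_le (norm_nonneg x)).1 le_rfl n

/-- The coordinate functionals of `c₀`. -/
def coordCLM (n : ℕ) : CZero →L[ℂ] ℂ :=
  LinearMap.mkContinuous
    { toFun := fun x => x n
      map_add' := fun _ _ => rfl
      map_smul' := fun _ _ => rfl } 1 fun x => by
    rw [one_mul]
    exact x.norm_apply_le n

@[simp] theorem coordCLM_apply (n : ℕ) (x : CZero) : coordCLM n x = x n := rfl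

theorem unitVec_apply (n k : ℕ) : unitVec n k = if k = n then 1 else 0 :=
  Pi.single_apply n (1 : ℂ) k

/-- The truncation of a sequence to its first `N` coordinates. -/
def trunc (N : ℕ) (z : ℕ → ℂ) : CZero := ∑ n ∈ Finset.range N, z n • unitVec n

theorem trunc_apply (N : ℕ) (z : ℕ → ℂ) (k : ℕ) : trunc N z k = if k < N then z k else 0 := by
  rw [← coordCLM_apply, trunc, map_sum]
  simp [unitVec_apply]

theorem tendsto_trunc (x : CZero) : Tendsto (fun N => trunc N x) atTop (𝓝 x) := by
  have hx : Tendsto x atTop (𝓝 0) := cocompact_eq_atTop (α := ℕ) ▸ zero_at_infty x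
  refine Metric.tendsto_atTop.2 fun ε hε => ?_
  obtain ⟨N, hN⟩ := Metric.tendsto_atTop.1 hx (ε / 2) (half_pos hε)
  refine ⟨N, fun M hM => ?_⟩
  rw [dist_eq_norm]
  refine ((CZero.norm_le (half_pos hε).le).2 fun n => ?_).trans_lt (half_lt_self hε)
  rw [ZeroAtInftyContinuousMap.sub_apply, trunc_apply]
  split_ifs with hn
  · simpa using (half_pos hε).le
  · simpa using (hN n (by omega)).le

/-- The coordinates of a point of the polytorus. -/
abbrev Polytorus.coords (w : Polytorus) : ℕ → ℂ := fun n => w n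

theorem continuous_trunc_coords (N : ℕ) : Continuous fun w : Polytorus => trunc N w.coords := by
  unfold trunc
  fun_prop

section HomPolyCZero

variable {m : ℕ} {X : Type*} [NormedAddCommGroup X] [NormedSpace ℂ X]

theorem HomPoly.continuous (P : HomPoly m X) : Continuous P := by
  obtain ⟨A, hA⟩ := P.exists_form
  rw [show (P : X → ℂ) = fun x => A fun _ => x from funext hA]
  fun_prop

theorem HomPoly.differentiable (P : HomPoly m X) : Differentiable ℂ P := by
  obtain ⟨A, hA⟩ := P.exists_form
  rw [show (P : X → ℂ) = fun x => A fun _ => x from funext hA]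
  exact (A.contDiff (n := 1)).differentiable one_ne_zero |>.comp
    (differentiable_pi.2 fun _ => differentiable_id)

theorem HomPoly.norm_le_of_norm_apply_trunc_le {P : HomPoly m CZero} {C : ℝ}
    (h : ∀ N (w : Polytorus), ‖P (trunc N w.coords)‖ ≤ C) : ‖P‖ ≤ C := by
  refine HomPoly.norm_le fun x hx => le_of_tendsto
    ((P.continuous.tendsto x).comp (tendsto_trunc x)).norm (Eventually.of_forall fun N => ?_)
  let f (z : Fin N → ℂ) : ℂ := P (∑ n : Fin N, z n • unitVec n)
  have hf : Differentiable ℂ f := P.differentiable.comp (by fun_prop)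
  have htorus (z : Fin N → ℂ) (hz : ∀ n, ‖z n‖ = 1) : ‖f z‖ ≤ C := by
    let w : Polytorus := fun n =>
      if hn : n < N then ⟨z ⟨n, hn⟩, mem_sphere_zero_iff_norm.2 (hz _)⟩ else 1
    have hw (n : Fin N) : w.coords n = z n := by simp [w, Polytorus.coords]
    simpa only [trunc, Finset.sum_range, hw] using h N w
  have hdisc := norm_le_of_norm_le_on_torus hf htorus (z := fun n => x n)
    fun n => (x.norm_apply_le n).trans hx
  rwa [Function.comp_apply, trunc, Finset.sum_range]

theorem HomPoly.apply_trunc_coords (P : HomPoly m CZero) (N : ℕ) (w : Polytorus) :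
    P (trunc N w.coords) = ∑ r ∈ Fintype.piFinset fun _ : Fin m => Finset.range N,
      P.symmForm (unitVec ∘ r) * torusMonomial (multiIndex r) w := by
  rw [P.symmForm_diag]
  exact form_sum_torus_smul P.symmForm (Finset.range N) id unitVec w

end HomPolyCZero

/-! ### The Aron–Berner extension on the polytorus -/

theorem forall_le_of_ae_le {Y : Type*} [TopologicalSpace Y] [MeasurableSpace Y] {μ : Measure Y}
    [μ.IsOpenPosMeasure] {f : Y → ℝ} (hf : Continuous f) {C : ℝ} (h : ∀ᵐ y ∂μ, f y ≤ C) (y : Y) :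
    f y ≤ C :=
  (isClosed_le hf continuous_const).closure_subset (Measure.dense_of_ae h y)

section RootsOfUnity

variable {m : ℕ} {E : Type*} [NormedAddCommGroup E] [NormedSpace ℂ E]

theorem form_add_smul (A : Form m E) (x y : E) (c : ℂ) : (A fun _ => x + c • y) =
    ∑ s : Finset (Fin m), c ^ s.card * A (s.piecewise (fun _ => y) fun _ => x) := by
  have hadd : (fun _ : Fin m => x + c • y) = (fun _ => c • y) + fun _ => x :=
    funext fun _ => add_comm _ _
  rw [hadd, A.map_add_univ]
  refine Finset.sum_congr rfl fun s _ => ?_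
  have hsmul : s.piecewise (fun _ => c • y) (fun _ => x) =
      s.piecewise (fun i => c • s.piecewise (fun _ => y) (fun _ => x) i)
        (s.piecewise (fun _ => y) fun _ => x) := by
    ext i
    by_cases hi : i ∈ s <;> simp [hi]
  rw [hsmul, A.map_piecewise_smul (fun _ => c)]
  simp

theorem sum_form_add_circleRoot_smul (A : Form m E) (x y : E) :
    ∑ j ∈ Finset.range (m + 1), (A fun _ => x + (circleRoot m : ℂ) ^ j • y) =
      (m + 1) * A fun _ => x := by
  simp only [form_add_smul]
  rw [Finset.sum_comm]
  simp only [← Finset.sum_mul, sum_circleRoot_pow (card_finset_fin_le _), Finset.card_eq_zero,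
    ite_mul, zero_mul, Finset.sum_ite_eq', Finset.mem_univ, if_true, Finset.piecewise_empty]

end RootsOfUnity

theorem inclusionInDoubleDual_trunc_apply (N : ℕ) (w : Polytorus) (φ : StrongDual ℂ CZero) :
    NormedSpace.inclusionInDoubleDual ℂ CZero (trunc N w.coords) φ =
      ∑ n ∈ Finset.range N, (w n : ℂ) * φ (unitVec n) := by
  simp [NormedSpace.dual_def, trunc]

theorem toBidual_tailRot_mul (N : ℕ) (c : Circle) (w : Polytorus) :
    toBidual (tailRot N c * w).toLInfty =
      NormedSpace.inclusionInDoubleDual ℂ CZero (trunc N w.coords) +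
        (c : ℂ) • (toBidual w.toLInfty -
          NormedSpace.inclusionInDoubleDual ℂ CZero (trunc N w.coords)) := by
  ext φ
  have hsplit (v : Polytorus) : toBidual v.toLInfty φ =
      ∑ n ∈ Finset.range N, (v n : ℂ) * φ (unitVec n) +
        ∑' n, (v (n + N) : ℂ) * φ (unitVec (n + N)) :=
    ((summable_mul_apply_unitVec v.toLInfty φ).sum_add_tsum_nat_add N).symm
  have hhead : ∑ n ∈ Finset.range N, ((tailRot N c * w) n : ℂ) * φ (unitVec n) =
      ∑ n ∈ Finset.range N, (w n : ℂ) * φ (unitVec n) :=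
    Finset.sum_congr rfl fun n hn => by simp [tailRot, Finset.mem_range.1 hn]
  have htail : ∑' n, ((tailRot N c * w) (n + N) : ℂ) * φ (unitVec (n + N)) =
      c * ∑' n, (w (n + N) : ℂ) * φ (unitVec (n + N)) := by
    rw [← tsum_mul_left]
    exact tsum_congr fun n => by simp [tailRot, mul_assoc]
  simp only [_root_.add_apply, _root_.smul_apply, _root_.sub_apply, smul_eq_mul, hsplit, hhead,
    htail, inclusionInDoubleDual_trunc_apply]
  ring

theorem norm_toBidual_toLInfty_le (w : Polytorus) : ‖toBidual w.toLInfty‖ ≤ 1 :=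
  (LinearMap.mkContinuous_norm_le _ (norm_nonneg _) _).trans <|
    lp.norm_le_of_forall_le zero_le_one fun _ => (Circle.norm_coe _).le

/-- The restriction of the Aron–Berner extension to the polytorus. -/
def torusExt {m : ℕ} (P : HomPoly m CZero) (w : Polytorus) : ℂ :=
  aronBerner P (toBidual w.toLInfty)

section TorusExt

variable {m : ℕ}

theorem measurable_arens_toBidual (A : Form m CZero) :
    Measurable fun w : Polytorus => arens CZero m A fun _ => toBidual w.toLInfty := by
  induction m with
  | zero => exact measurable_const
  | succ m ih =>
    have hlim : ∀ w : Polytorus, Tendsto (fun N => ∑ n ∈ Finset.range N, (w n : ℂ) *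
        arens CZero m (A.curryLeft (unitVec n)) fun _ => toBidual w.toLInfty) atTop
        (𝓝 (arens CZero (m + 1) A fun _ => toBidual w.toLInfty)) := fun w =>
      (summable_mul_apply_unitVec w.toLInfty
        (((arens CZero m) ∘L A.curryLeft).flipMultilinear
          fun _ => toBidual w.toLInfty)).hasSum.tendsto_sum_nat
    refine measurable_of_tendsto_metrizable (fun N => ?_) (tendsto_pi_nhds.2 hlim)
    refine Finset.measurable_sum _ fun n _ => ?_
    exact (continuous_subtype_val.comp (continuous_apply n)).measurable.mul (ih _)

theorem memLp_torusExt (P : HomPoly m CZero) (p : ℝ≥0∞) :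
    MemLp (torusExt P) p polytorusMeasure :=
  .of_bound (measurable_arens_toBidual P.symmForm).aestronglyMeasurable ‖aronBerner P‖ <|
    ae_of_all _ fun w => (aronBerner P).norm_apply_le (norm_toBidual_toLInfty_le w)

theorem integrable_torusExt (P : HomPoly m CZero) : Integrable (torusExt P) polytorusMeasure :=
  (memLp_torusExt P 1).integrable le_rfl

theorem tailMean_torusExt (P : HomPoly m CZero) (N : ℕ) (w : Polytorus) :
    tailMean m N (torusExt P) w = P (trunc N w.coords) := by
  have hm : (m + 1 : ℂ) ≠ 0 := m.cast_add_one_ne_zero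
  have hroot (j : ℕ) : torusExt P (tailRot N (circleRoot m ^ j) * w) =
      arens CZero m P.symmForm fun _ =>
        NormedSpace.inclusionInDoubleDual ℂ CZero (trunc N w.coords) + (circleRoot m : ℂ) ^ j •
          (toBidual w.toLInfty - NormedSpace.inclusionInDoubleDual ℂ CZero (trunc N w.coords)) := by
    rw [torusExt, toBidual_tailRot_mul, Circle.coe_pow]
    rfl
  simp only [tailMean, hroot]
  rw [sum_form_add_circleRoot_smul, arens_inclusion, ← P.symmForm_diag, inv_mul_cancel_left₀ hm]

theorem ae_norm_torusExt_le (P : HomPoly m CZero) :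
    ∀ᵐ w ∂polytorusMeasure, ‖torusExt P w‖ ≤ ‖P‖ := by
  refine ae_norm_le_of_ae_norm_tailMean_le (m := m) (integrable_torusExt P) fun N =>
    ae_of_all _ fun w => ?_
  rw [tailMean_torusExt]
  refine P.norm_apply_le ((CZero.norm_le zero_le_one).2 fun n => ?_)
  rw [trunc_apply]
  split_ifs
  · exact (Circle.norm_coe _).le
  · exact norm_zero.trans_le zero_le_one

theorem HomPoly.norm_le_of_ae_norm_torusExt_le {P : HomPoly m CZero} {C : ℝ}
    (h : ∀ᵐ w ∂polytorusMeasure, ‖torusExt P w‖ ≤ C) : ‖P‖ ≤ C := by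
  refine HomPoly.norm_le_of_norm_apply_trunc_le fun N =>
    forall_le_of_ae_le (μ := polytorusMeasure)
      (P.continuous.comp (continuous_trunc_coords N)).norm ?_
  simpa only [tailMean_torusExt, Function.comp_apply] using ae_norm_tailMean_le (m := m) (N := N) h

end TorusExt

/-! ### The range of the extension -/

section Range

variable {m : ℕ}

theorem exists_multiIndex_eq_of_torusCoeff_torusExt_ne_zero {P : HomPoly m CZero} {α : ℕ →₀ ℤ}
    (h : torusCoeff (torusExt P) α ≠ 0) : ∃ r : Fin m → ℕ, multiIndex r = α := by
  obtain ⟨N, hN⟩ := α.support.exists_nat_subset_range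
  rw [← torusCoeff_tailMean_of_support (m := m) (integrable_torusExt P) hN,
    funext (tailMean_torusExt P N), funext (P.apply_trunc_coords N),
    torusCoeff_sum_mul_torusMonomial] at h
  obtain ⟨r, -, hr⟩ := Finset.exists_ne_zero_of_sum_ne_zero h
  exact ⟨r, of_not_not fun hne => hr (if_neg hne)⟩

/-- The part of the Fourier series of `f` which is `m`-homogeneous in the first `N` variables. -/
def fourierPartialSum (m : ℕ) (f : Polytorus → ℂ) (N : ℕ) (w : Polytorus) : ℂ :=
  ∑ α ∈ homIndices m N, torusCoeff f α * torusMonomial α w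

theorem continuous_fourierPartialSum (f : Polytorus → ℂ) (N : ℕ) :
    Continuous (fourierPartialSum m f N) :=
  continuous_finsetSum _ fun α _ => continuous_const.mul (continuous_torusMonomial α)

theorem memLp_fourierPartialSum (f : Polytorus → ℂ) (N : ℕ) (p : ℝ≥0∞) :
    MemLp (fourierPartialSum m f N) p polytorusMeasure :=
  (continuous_fourierPartialSum f N).memLp_of_hasCompactSupport (.of_compactSpace _)

theorem torusCoeff_fourierPartialSum (f : Polytorus → ℂ) (N : ℕ) (α : ℕ →₀ ℤ) :
    torusCoeff (fourierPartialSum m f N) α = if α ∈ homIndices m N then torusCoeff f α else 0 :=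
  (torusCoeff_sum_mul_torusMonomial _ _ _ _).trans (Finset.sum_ite_eq' _ _ _)

theorem tailMean_ae_eq_fourierPartialSum {f : Polytorus → ℂ} (hf : MemLp f 2 polytorusMeasure)
    (hspec : ∀ α, torusCoeff f α ≠ 0 → ∃ r : Fin m → ℕ, multiIndex r = α) (N : ℕ) :
    tailMean m N f =ᵐ[polytorusMeasure] fourierPartialSum m f N := by
  have hf1 := hf.integrable one_le_two
  refine ae_eq_of_torusCoeff_eq (memLp_tailMean hf m N) (memLp_fourierPartialSum f N 2) fun α => ?_
  rw [torusCoeff_fourierPartialSum]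
  by_cases h0 : torusCoeff f α = 0
  · rw [torusCoeff_tailMean hf1, h0, mul_zero, ite_self]
  · obtain ⟨r, rfl⟩ := hspec α h0
    simp only [torusCoeff_tailMean_multiIndex hf1, multiIndex_mem_homIndices]

theorem norm_fourierPartialSum_le {f : Polytorus → ℂ} (hf : MemLp f 2 polytorusMeasure) {C : ℝ}
    (hC : ∀ᵐ w ∂polytorusMeasure, ‖f w‖ ≤ C)
    (hspec : ∀ α, torusCoeff f α ≠ 0 → ∃ r : Fin m → ℕ, multiIndex r = α) (N : ℕ)
    (w : Polytorus) : ‖fourierPartialSum m f N w‖ ≤ C := by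
  refine forall_le_of_ae_le (μ := polytorusMeasure) (continuous_fourierPartialSum f N).norm ?_ w
  filter_upwards [tailMean_ae_eq_fourierPartialSum hf hspec N,
    ae_norm_tailMean_le (m := m) (N := N) hC] with v hv hle
  rwa [← hv]

/-- The polynomial `x ↦ ∏ j, x (r j)` on `c₀`. -/
def coordMonomial (r : Fin m → ℕ) : HomPoly m CZero :=
  ⟨fun x => ∏ j, x (r j), (ContinuousMultilinearMap.mkPiAlgebra ℂ (Fin m)
    ℂ).compContinuousLinearMap fun j => coordCLM (r j), fun _ => rfl⟩

theorem coordMonomial_trunc_coords (r : Fin m → ℕ) (N : ℕ) (w : Polytorus) :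
    coordMonomial r (trunc N w.coords) =
      if multiIndex r ∈ homIndices m N then torusMonomial (multiIndex r) w else 0 := by
  change ∏ j, trunc N w.coords (r j) = _
  simp only [trunc_apply, Finset.prod_ite_zero, multiIndex_mem_homIndices,
    torusMonomial_multiIndex, Finset.mem_univ, true_imp_iff]

theorem HomPoly.sum_apply {ι X : Type*} [NormedAddCommGroup X] [NormedSpace ℂ X] (s : Finset ι)
    (P : ι → HomPoly m X) (x : X) : (∑ i ∈ s, P i) x = ∑ i ∈ s, P i x :=
  map_sum ((Pi.evalAddMonoidHom (fun _ : X => ℂ) x).comp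
    (homPolySubmodule m X).subtype.toAddMonoidHom) P s

/-- The polynomial on `c₀` whose monomial series is the part of the Fourier series of `f` which is
`m`-homogeneous in the first `M` variables. -/
def fourierPoly (m : ℕ) (f : Polytorus → ℂ) (M : ℕ) : HomPoly m CZero :=
  ∑ α ∈ homIndices m M, torusCoeff f α • coordMonomial (Function.invFun multiIndex α)

theorem fourierPoly_trunc_coords (f : Polytorus → ℂ) (M N : ℕ) (w : Polytorus) :
    fourierPoly m f M (trunc N w.coords) = fourierPartialSum m f (min M N) w := by
  have hterm : ∀ α ∈ homIndices m M,
      (torusCoeff f α • coordMonomial (m := m) (Function.invFun multiIndex α)) (trunc N w.coords) =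
        if α ∈ homIndices m N then torusCoeff f α * torusMonomial α w else 0 := fun α hα => by
    rw [HomPoly.smul_apply, coordMonomial_trunc_coords,
      Function.invFun_eq (exists_multiIndex_eq_of_mem_homIndices hα), mul_ite, mul_zero]
  rw [fourierPoly, HomPoly.sum_apply, Finset.sum_congr rfl hterm, Finset.sum_ite_mem,
    homIndices_inter, fourierPartialSum]

theorem exists_torusExt_ae_eq {f : Polytorus → ℂ} {C : ℝ} (hf : MemLp f 2 polytorusMeasure)
    (hC : ∀ᵐ w ∂polytorusMeasure, ‖f w‖ ≤ C)
    (hspec : ∀ α, torusCoeff f α ≠ 0 → ∃ r : Fin m → ℕ, multiIndex r = α) :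
    ∃ P : HomPoly m CZero, torusExt P =ᵐ[polytorusMeasure] f := by
  have hbound (M : ℕ) : ‖fourierPoly m f M‖ ≤ C :=
    HomPoly.norm_le_of_norm_apply_trunc_le fun N w => by
      rw [fourierPoly_trunc_coords]
      exact norm_fourierPartialSum_le hf hC hspec _ w
  obtain ⟨P, hP⟩ := HomPoly.exists_tendsto_ultrafilter (hyperfilter ℕ) hbound
  have htrunc (N : ℕ) (w : Polytorus) : P (trunc N w.coords) = fourierPartialSum m f N w := by
    refine tendsto_nhds_unique (hP _) (tendsto_const_nhds.congr' ?_)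
    filter_upwards [Nat.hyperfilter_le_atTop (eventually_ge_atTop N)] with M hM
    rw [fourierPoly_trunc_coords, min_eq_right hM]
  refine ⟨P, ae_eq_of_tailMean_ae_eq (m := m) (memLp_torusExt P 2) hf fun N => ?_⟩
  rw [funext (tailMean_torusExt P N), funext (htrunc N)]
  exact (tailMean_ae_eq_fourierPartialSum hf hspec N).symm

end Range

/-! ### The isometry -/

section Isometry

variable {m : ℕ}

theorem HomPoly.symmForm_add {X : Type*} [NormedAddCommGroup X] [NormedSpace ℂ X]
    (P Q : HomPoly m X) : (P + Q).symmForm = P.symmForm + Q.symmForm := by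
  refine (P + Q).symmForm_isSymm.ext_diag (fun σ v => ?_) fun x => ?_
  · simp only [_root_.add_apply, P.symmForm_isSymm σ v, Q.symmForm_isSymm σ v]
  · simp only [_root_.add_apply, ← HomPoly.symmForm_diag, HomPoly.add_apply]

theorem HomPoly.symmForm_smul {X : Type*} [NormedAddCommGroup X] [NormedSpace ℂ X]
    (c : ℂ) (P : HomPoly m X) : (c • P).symmForm = c • P.symmForm := by
  refine (c • P).symmForm_isSymm.ext_diag (fun σ v => ?_) fun x => ?_
  · simp only [_root_.smul_apply, P.symmForm_isSymm σ v]
  · simp only [_root_.smul_apply, ← HomPoly.symmForm_diag, HomPoly.smul_apply, smul_eq_mul]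

theorem torusExt_add (P Q : HomPoly m CZero) : torusExt (P + Q) = torusExt P + torusExt Q := by
  ext w
  change arens CZero m (P + Q).symmForm _ = _
  rw [HomPoly.symmForm_add, map_add]
  rfl

theorem torusExt_smul (c : ℂ) (P : HomPoly m CZero) : torusExt (c • P) = c • torusExt P := by
  ext w
  change arens CZero m (c • P).symmForm _ = _
  rw [HomPoly.symmForm_smul, _root_.map_smul]
  rfl

theorem toLp_torusExt_mem_hardyHom (P : HomPoly m CZero) :
    (memLp_torusExt P ∞).toLp (torusExt P) ∈ hardyHom ∞ m := by
  have hspec (α : ℕ →₀ ℤ) (h : torusCoeff ((memLp_torusExt P ∞).toLp (torusExt P)) α ≠ 0) :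
      ∃ r : Fin m → ℕ, multiIndex r = α := by
    rw [torusCoeff_congr (memLp_torusExt P ∞).coeFn_toLp] at h
    exact exists_multiIndex_eq_of_torusCoeff_torusExt_ne_zero h
  refine ⟨fun α hα => ?_, fun α hα => ?_⟩
  · by_contra h
    obtain ⟨r, rfl⟩ := hspec α h
    exact hα (multiIndex_nonneg r)
  · obtain ⟨r, rfl⟩ := hspec α hα
    rw [sum_multiIndex, Fintype.card_fin]

theorem ae_norm_le_norm_of_top {Y E : Type*} [MeasurableSpace Y] {μ : Measure Y}
    [NormedAddCommGroup E] (f : Lp E ∞ μ) : ∀ᵐ y ∂μ, ‖f y‖ ≤ ‖f‖ := by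
  rw [Lp.norm_def, toReal_eLpNorm (Lp.aestronglyMeasurable f)]
  exact ae_le_lpNorm_exponent_top (Lp.memLp f)

theorem norm_toLp_torusExt (P : HomPoly m CZero) :
    ‖(memLp_torusExt P ∞).toLp (torusExt P)‖ = ‖P‖ := by
  have hcoe := (memLp_torusExt P ∞).coeFn_toLp
  refine le_antisymm ?_ (HomPoly.norm_le_of_ae_norm_torusExt_le ?_)
  · have hle := Lp.norm_le_of_ae_bound (f := (memLp_torusExt P ∞).toLp (torusExt P))
      (norm_nonneg P) <| by
        filter_upwards [hcoe, ae_norm_torusExt_le P] with w hw hle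
        rwa [hw]
    simpa using hle
  · filter_upwards [hcoe, ae_norm_le_norm_of_top ((memLp_torusExt P ∞).toLp (torusExt P))]
      with w hw hle
    rwa [← hw]

/-- The map `P ↦ AB(P)|_{𝕋^∞}` as a linear isometry. -/
def torusExtIsometry (m : ℕ) : HomPoly m CZero →ₗᵢ[ℂ] hardyHom ∞ m where
  toFun P := ⟨(memLp_torusExt P ∞).toLp (torusExt P), toLp_torusExt_mem_hardyHom P⟩
  map_add' P Q := Subtype.ext <| by
    simp only [torusExt_add, MemLp.toLp_add (memLp_torusExt P ∞) (memLp_torusExt Q ∞),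
      Submodule.coe_add]
  map_smul' c P := Subtype.ext <| by
    simp only [torusExt_smul, MemLp.toLp_const_smul c (memLp_torusExt P ∞), RingHom.id_apply,
      Submodule.coe_smul]
  norm_map' := norm_toLp_torusExt

theorem torusExtIsometry_surjective (m : ℕ) : Function.Surjective (torusExtIsometry m) := by
  rintro ⟨f, hanalytic, hhom⟩
  have hspec (α : ℕ →₀ ℤ) (hα : torusCoeff f α ≠ 0) : ∃ r : Fin m → ℕ, multiIndex r = α :=
    exists_multiIndex_eq (of_not_not fun h => hα (hanalytic α h)) (hhom α hα)
  obtain ⟨P, hP⟩ := exists_torusExt_ae_eq ((Lp.memLp f).mono_exponent le_top)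
    (ae_norm_le_norm_of_top f) hspec
  exact ⟨P, Subtype.ext (Lp.ext ((memLp_torusExt P ∞).coeFn_toLp.trans hP))⟩

end Isometry

end AronBerner

end

open AronBerner in
theorem proposition4p1 (m : ℕ) :
    ∃ ψ : HomPoly m CZero ≃ₗᵢ[ℂ] hardyHom ∞ m,
      ∀ P : HomPoly m CZero,
        (ψ P : Polytorus → ℂ) =ᵐ[polytorusMeasure]
          fun w => aronBerner P (toBidual w.toLInfty) := by
  exact ⟨.ofSurjective (torusExtIsometry m) (torusExtIsometry_surjective m),
    fun P => (memLp_torusExt P ∞).coeFn_toLp⟩
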